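/- Let $h,k\ge 0$ be integers and let $X_1,X_2,\dots$ be i.i.d. $\mathbb{R}^h$-valued random variables on a probability space $(\Omega,\mathcal F,P)$ such that $\mathbb{E}[e^{\langle\theta,X_1\rangle}]<\infty$ for all $\theta$ in a neighbourhood of $0\in\mathbb{R}^h$. Put $\kappa_X(\theta)=\log\mathbb{E}[e^{\langle\theta,X_1\rangle}]$. Then $\kappa_X$ is differentiable in a neighbourhood of $0$ and its gradient $\nabla\kappa_X$ is differentiable at $0$; let $H\kappa_X(0)$ be the Hessian of $\kappa_X$ at $0$, and for $x\in\mathbb{R}^h$ let $$\widetilde\kappa_X^*(x)=\sup_{\theta\in\mathbb{R}^h}\Big\{\langle\theta,x\rangle-\tfrac12\langle\theta,H\kappa_X(0)\theta\rangle\Big\}\in[0,\infty].$$ Let $(a_n)_{n\ge1}$ be any sequence of positive numbers with $a_n\to0$ and $na_n\to\infty$, and put $$B_n=\frac{X_1+\cdots+X_n-n\nabla\kappa_X(0)}{\sqrt{n/a_n}}.$$ Let $D\subseteq\mathbb{R}^h$ and let $U:D\to\mathbb{R}^k$ be continuous, where $P(B_n\in D)=1$ for every $n\ge1$ and $\widetilde\kappa_X^*=\infty$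 on $\overline{D}\setminus D$ (both conditions hold trivially if $D=\mathbb{R}^h$; the second one holds trivially if $D$ is closed). Then the sequence $(U(B_n))_{n\ge1}$ satisfies the large deviation principle in $\mathbb{R}^k$ with speed $1/a_n$ and rate function $$I_{\mathrm{MD},U}(y)=\inf\{\widetilde\kappa_X^*(x): x\in D,\ U(x)=y\}\qquad(y\in\mathbb{R}^k,\ \inf\emptyset=\infty),$$ and this rate function is good. That is, $1/a_n\to\infty$; the function $I_{\mathrm{MD},U}:\mathbb{R}^k\to[0,\infty]$ is lower semicontinuous with compact level sets $\{I_{\mathrm{MD},U}\le\eta\}$ for all $\eta\in[0,\infty)$; and (with $\log 0=-\infty$) $$\limsup_{n\to\infty}a_n\log P(U(B_n)\in C)\le-\inf_{y\in C}I_{\mathrm{MD},U}(y)\ \text{ for all closed } C\subseteq\mathbb{R}^k,$$ $$\liminf_{n\to\infty}a_n\log P(U(B_n)\in O)\ge-\inf_{y\in O}I_{\mathrm{MD},U}(y)\ \text{ for all open } O\subseteq\mathbb{R}^k.$$ -/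

import Mathlib

open MeasureTheory ProbabilityTheory Filter Topology
open scoped InnerProductSpace

/-- `I` is a rate function: lower semicontinuous with values in `[0, ∞]`. -/
def IsRateFunction {S : Type*} [TopologicalSpace S] (I : S → EReal) : Prop :=
  (∀ x, 0 ≤ I x) ∧ LowerSemicontinuous I

/-- `I` is a good rate function: a rate function with compact level sets `{I ≤ η}`, `0 ≤ η < ∞`. -/
def IsGoodRateFunction {S : Type*} [TopologicalSpace S] (I : S → EReal) : Prop :=
  IsRateFunction I ∧ ∀ η : ℝ, 0 ≤ η → IsCompact {x | I x ≤ (η : EReal)}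

/-- The sequence `B` (of random elements of `S`, under the probability `P`) satisfies the large
deviation principle with speed `v` and rate function `I`. Here `ENNReal.log 0 = ⊥`, and the
infimum over the empty set is `⊤`, in the extended reals. -/
def SatisfiesLDP {Ω S : Type*} [MeasurableSpace Ω] [TopologicalSpace S] (P : Measure Ω)
    (B : ℕ → Ω → S) (v : ℕ → ℝ) (I : S → EReal) : Prop :=
  Tendsto v atTop atTop ∧
  IsRateFunction I ∧
  (∀ C : Set S, IsClosed C →
    limsup (fun n => ((1 / v n : ℝ) : EReal) * ENNReal.log (P {ω | B n ω ∈ C})) atTop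
      ≤ -(⨅ x ∈ C, I x)) ∧
  (∀ O : Set S, IsOpen O →
    -(⨅ x ∈ O, I x)
      ≤ liminf (fun n => ((1 / v n : ℝ) : EReal) * ENNReal.log (P {ω | B n ω ∈ O})) atTop)

/-- The logarithm of the moment generating function, `κ_X(θ) = log E[exp ⟨θ, X⟩]`
(used at the points `θ` where the expectation is finite). -/
noncomputable def logMGF {Ω E : Type*} [MeasurableSpace Ω] [NormedAddCommGroup E]
    [InnerProductSpace ℝ E] (P : Measure Ω) (X : Ω → E) (θ : E) : ℝ :=
  Real.log (∫ ω, Real.exp ⟪θ, X ω⟫_ℝ ∂P)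

/-- The Hessian of `f` at `x`, as the linear operator that is the derivative of the gradient. -/
noncomputable def hessian {E : Type*} [NormedAddCommGroup E] [InnerProductSpace ℝ E]
    [CompleteSpace E] (f : E → ℝ) (x : E) : E →L[ℝ] E :=
  fderiv ℝ (gradient f) x

/-- `x ↦ sup_θ (⟨θ, x⟩ - ⟨θ, H θ⟩ / 2)`, with values in the extended reals. -/
noncomputable def quadConjugate {E : Type*} [NormedAddCommGroup E] [InnerProductSpace ℝ E]
    (H : E →L[ℝ] E) (x : E) : EReal :=
  ⨆ θ : E, ((⟪θ, x⟫_ℝ - ⟪θ, H θ⟫_ℝ / 2 : ℝ) : EReal)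

/-- `y ↦ inf {I(x) : x ∈ D, U(x) = y}`, for a map `U` that is considered on `D` only. -/
noncomputable def contractedRate {S T : Type*} (I : S → EReal) (D : Set S) (U : S → T) (y : T) :
    EReal :=
  ⨅ x ∈ {x | x ∈ D ∧ U x = y}, I x

/-- `(X_1 + ⋯ + X_n - n ∇κ_X(0)) / √(n / a_n)`, where `X_1, X_2, …` are `X 0, X 1, …`. -/
noncomputable def scaledSum {Ω E : Type*} [MeasurableSpace Ω] [NormedAddCommGroup E]
    [InnerProductSpace ℝ E] [CompleteSpace E] (P : Measure Ω) (X : ℕ → Ω → E) (a : ℕ → ℝ)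
    (n : ℕ) (ω : Ω) : E :=
  (Real.sqrt (n / a n))⁻¹ •
    ((∑ i ∈ Finset.range n, X i ω) - (n : ℝ) • gradient (logMGF P (X 0)) 0)

/-! This is the Gärtner–Ellis argument with a quadratic limit, followed by contraction along `U`.
With `t = (n a_n)^(-1/2)`, independence gives `a_n log E exp(⟨θ, B_n⟩ / a_n) = (κ(tθ) - t⟨θ, ∇κ(0)⟩)
/ t²`, and since `t → 0` a second order Taylor expansion gives the limit `⟨θ, Hθ⟩ / 2`, with `H` the
Hessian (`eventually_lintegral_exp_inner_scaledSum`).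

Upper bound: a closed set on which the conjugate exceeds `l` is covered by finitely many
half-spaces, including those that control large norms, and each one is estimated by Chebyshev; no
separate exponential tightness is needed. Lower bound: tilting by `exp(⟨η, x⟩ / a_n)` moves the
concentration point to `Hη`, because the upper bound makes the rest of the tilted mass negligible.
`H` may be singular, but the conjugate is infinite off its range, so the points `Hη` suffice.

Contraction: infinite rate on `closure D \ D` puts the part of each level set in `closure D` inside
`D`. There `U` is continuous on a compact set, and the usual proof applies. -/

/-! ### Smoothness of the logarithmic moment generating function. -/

section LogMGF

variable {Ω E : Type*} [MeasurableSpace Ω] [NormedAddCommGroup E] [InnerProductSpace ℝ E]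

/-- The norm is at most the sum of the absolute coordinates, so some coordinate reaches their
average. `x ≠ 0` rules out dimension zero, where there is no index. -/
lemma OrthonormalBasis.exists_norm_le_card_mul_abs_inner {ι : Type*} [Fintype ι]
    (b : OrthonormalBasis ι ℝ E) (x : E) (hx : x ≠ 0) :
    ∃ i, ‖x‖ ≤ Fintype.card ι * |⟪b i, x⟫_ℝ| := by
  have hsum : ‖x‖ ≤ ∑ i, |⟪b i, x⟫_ℝ| := by
    conv_lhs => rw [← b.sum_repr' x]
    refine (norm_sum_le _ _).trans (Finset.sum_le_sum fun i _ => ?_)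
    simp [norm_smul]
  by_contra! hlt
  rcases isEmpty_or_nonempty ι with hι | hι
  · exact hx (norm_le_zero_iff.1 (by simpa using hsum))
  · have hc : (0 : ℝ) < Fintype.card ι := by exact_mod_cast Fintype.card_pos
    have : ∑ i, |⟪b i, x⟫_ℝ| < ∑ _i : ι, ‖x‖ / Fintype.card ι :=
      Finset.sum_lt_sum_of_nonempty Finset.univ_nonempty fun i _ => by
        rw [lt_div_iff₀' hc]; exact hlt i
    rw [Finset.sum_const, Finset.card_univ, nsmul_eq_mul, mul_div_cancel₀ _ hc.ne'] at this
    linarith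

variable [FiniteDimensional ℝ E] [MeasurableSpace E] [BorelSpace E]

/-- If the moment generating function is finite near `0`, some exponential moment of the norm
is finite. -/
lemma exists_integrable_exp_mul_norm {P : Measure Ω} [IsFiniteMeasure P] {X : Ω → E}
    (hX : Measurable X)
    (hmgf : ∀ᶠ θ in 𝓝 (0 : E), Integrable (fun ω => Real.exp ⟪θ, X ω⟫_ℝ) P) :
    ∃ r > 0, Integrable (fun ω => Real.exp (r * ‖X ω‖)) P := by
  obtain ⟨ε, hε, hball⟩ := Metric.eventually_nhds_iff_ball.1 hmgf
  set b := stdOrthonormalBasis ℝ E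
  set n : ℝ := (Fintype.card (Fin (Module.finrank ℝ E)) : ℝ)
  have hn : 0 ≤ n := Nat.cast_nonneg _
  -- Chosen so that the vectors `± r n b i` lie in the ball of radius `ε`; the `n + 1` covers
  -- dimension zero.
  set r : ℝ := ε / (2 * (n + 1))
  have hr : 0 < r := by positivity
  have hrn : r * n < ε := by
    have : r * (2 * (n + 1)) = ε := div_mul_cancel₀ _ (by positivity)
    nlinarith
  have hint : ∀ i, ∀ σ : ℝ, |σ| = 1 →
      Integrable (fun ω => Real.exp (σ * (r * n * ⟪b i, X ω⟫_ℝ))) P := by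
    intro i σ hσ
    have := hball ((σ * (r * n)) • b i) (by
      simp only [mem_ball_zero_iff, norm_smul, b.norm_eq_one, mul_one, norm_mul,
        Real.norm_eq_abs, hσ, one_mul, ← abs_mul, abs_of_nonneg (mul_nonneg hr.le hn)]
      exact hrn)
    simpa [real_inner_smul_left, mul_assoc] using this
  -- The summand 1 dominates where `X` vanishes; elsewhere one coordinate controls the norm.
  refine ⟨r, hr, Integrable.mono' (g := fun ω => 1 + ∑ i,
    (Real.exp (1 * (r * n * ⟪b i, X ω⟫_ℝ)) + Real.exp (-1 * (r * n * ⟪b i, X ω⟫_ℝ)))) ?_ ?_ ?_⟩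
  · exact (integrable_const _).add (integrable_finsetSum _ fun i _ =>
      (hint i 1 (by simp)).add (hint i (-1) (by simp)))
  · exact (Real.measurable_exp.comp (hX.norm.const_mul r)).aestronglyMeasurable
  · refine ae_of_all _ fun ω => ?_
    rw [Real.norm_of_nonneg (Real.exp_pos _).le]
    by_cases hx : X ω = 0
    · simp only [hx, norm_zero, mul_zero, Real.exp_zero]
      exact le_add_of_nonneg_right (Finset.sum_nonneg fun i _ => by positivity)
    obtain ⟨i, hi⟩ := b.exists_norm_le_card_mul_abs_inner (X ω) hx
    have h1 : r * ‖X ω‖ ≤ |r * n * ⟪b i, X ω⟫_ℝ| := by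
      rw [abs_mul, abs_of_nonneg (mul_nonneg hr.le hn), mul_assoc]
      gcongr
    have h2 : Real.exp |r * n * ⟪b i, X ω⟫_ℝ| ≤
        Real.exp (1 * (r * n * ⟪b i, X ω⟫_ℝ)) + Real.exp (-1 * (r * n * ⟪b i, X ω⟫_ℝ)) := by
      rcases abs_choice (r * n * ⟪b i, X ω⟫_ℝ) with h | h <;> rw [h] <;> simp <;> positivity
    refine (Real.exp_le_exp.2 h1).trans (h2.trans ?_)
    refine (Finset.single_le_sum (f := fun i => Real.exp (1 * (r * n * ⟪b i, X ω⟫_ℝ)) +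
      Real.exp (-1 * (r * n * ⟪b i, X ω⟫_ℝ))) (fun i _ => by positivity)
      (Finset.mem_univ i)).trans ?_
    linarith

omit [FiniteDimensional ℝ E] [MeasurableSpace E] [BorelSpace E] in
-- Half of the exponent `r ‖x‖` pays for the inner product, the other half absorbs the power.
lemma norm_pow_mul_exp_inner_le {r : ℝ} (hr : 0 < r) (k : ℕ) {θ : E} (hθ : ‖θ‖ ≤ r / 2) (x : E) :
    ‖x‖ ^ k * Real.exp ⟪θ, x⟫_ℝ ≤ (k.factorial / (r / 2) ^ k) * Real.exp (r * ‖x‖) := by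
  have h1 : Real.exp ⟪θ, x⟫_ℝ ≤ Real.exp (r / 2 * ‖x‖) :=
    Real.exp_le_exp.2 ((real_inner_le_norm _ _).trans (by gcongr))
  have h2 := Real.pow_div_factorial_le_exp (r / 2 * ‖x‖) (by positivity) k
  have h3 : ‖x‖ ^ k ≤ (k.factorial / (r / 2) ^ k) * Real.exp (r / 2 * ‖x‖) := by
    rw [div_le_iff₀ (by positivity), mul_pow] at h2
    rw [div_mul_eq_mul_div, le_div_iff₀ (by positivity)]
    linarith
  have h4 : Real.exp (r * ‖x‖) = Real.exp (r / 2 * ‖x‖) * Real.exp (r / 2 * ‖x‖) := by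
    rw [← Real.exp_add]; ring_nf
  rw [h4, ← mul_assoc]
  gcongr

variable {F : Type*} [NormedAddCommGroup F] [NormedSpace ℝ F]

lemma integrable_exp_inner_smul {P : Measure Ω} {X : Ω → E} (hX : Measurable X) {r : ℝ}
    (hr : 0 < r) (hint : Integrable (fun ω => Real.exp (r * ‖X ω‖)) P) {g : Ω → F}
    (hg : AEStronglyMeasurable g P) {k : ℕ} (hgk : ∀ ω, ‖g ω‖ ≤ ‖X ω‖ ^ k) {θ : E}
    (hθ : ‖θ‖ ≤ r / 2) :
    Integrable (fun ω => Real.exp ⟪θ, X ω⟫_ℝ • g ω) P := by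
  refine Integrable.mono' (hint.const_mul (k.factorial / (r / 2) ^ k)) ?_ (ae_of_all _ fun ω => ?_)
  · exact (Real.measurable_exp.comp (hX.const_inner)).aestronglyMeasurable.smul hg
  · rw [norm_smul, Real.norm_of_nonneg (Real.exp_pos _).le, mul_comm]
    exact (mul_le_mul_of_nonneg_right (hgk ω) (Real.exp_pos _).le).trans
      (norm_pow_mul_exp_inner_le hr k hθ _)

/-- Differentiation only raises the growth order of `g` by one. The cases `g = 1` and `g = X` give
the first derivative of the generating function and that of the numerator of the gradient. -/
lemma hasFDerivAt_integral_exp_inner_smul {P : Measure Ω} {X : Ω → E} (hX : Measurable X) {r : ℝ}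
    (hr : 0 < r) (hint : Integrable (fun ω => Real.exp (r * ‖X ω‖)) P) {g : Ω → F}
    (hg : AEStronglyMeasurable g P) {k : ℕ} (hgk : ∀ ω, ‖g ω‖ ≤ ‖X ω‖ ^ k) {θ : E}
    (hθ : ‖θ‖ < r / 2) :
    HasFDerivAt (fun θ => ∫ ω, Real.exp ⟪θ, X ω⟫_ℝ • g ω ∂P)
      (∫ ω, Real.exp ⟪θ, X ω⟫_ℝ • (innerSL ℝ (X ω)).smulRight (g ω) ∂P) θ := by
  have hg' : AEStronglyMeasurable (fun ω => (innerSL ℝ (X ω)).smulRight (g ω)) P := by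
    have : AEStronglyMeasurable (fun ω => innerSL ℝ (X ω)) P :=
      (innerSL ℝ (E := E)).continuous.comp_aestronglyMeasurable hX.aestronglyMeasurable
    exact (ContinuousLinearMap.smulRightL ℝ E F).continuous₂.comp_aestronglyMeasurable
      (this.prodMk hg)
  have hgk' : ∀ ω, ‖(innerSL ℝ (X ω)).smulRight (g ω)‖ ≤ ‖X ω‖ ^ (k + 1) := fun ω => by
    rw [ContinuousLinearMap.norm_smulRight_apply, innerSL_apply_norm, pow_succ']
    exact mul_le_mul_of_nonneg_left (hgk ω) (norm_nonneg _)
  have hnhds : Metric.ball (0 : E) (r / 2) ∈ 𝓝 θ :=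
    Metric.isOpen_ball.mem_nhds (mem_ball_zero_iff.2 hθ)
  refine hasFDerivAt_integral_of_dominated_of_fderiv_le hnhds
    (F' := fun θ ω => Real.exp ⟪θ, X ω⟫_ℝ • (innerSL ℝ (X ω)).smulRight (g ω))
    (bound := fun ω => ((k + 1).factorial / (r / 2) ^ (k + 1)) * Real.exp (r * ‖X ω‖))
    ?_ (integrable_exp_inner_smul hX hr hint hg hgk hθ.le)
    (integrable_exp_inner_smul hX hr hint hg' hgk' hθ.le).aestronglyMeasurable
    (ae_of_all _ fun ω η hη => ?_) (hint.const_mul _) (ae_of_all _ fun ω η _ => ?_)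
  · filter_upwards [hnhds] with η hη
    exact (integrable_exp_inner_smul hX hr hint hg hgk
      (mem_ball_zero_iff.1 hη).le).aestronglyMeasurable
  · rw [norm_smul, Real.norm_of_nonneg (Real.exp_pos _).le, mul_comm]
    exact (mul_le_mul_of_nonneg_right (hgk' ω) (Real.exp_pos _).le).trans
      (norm_pow_mul_exp_inner_le hr (k + 1) (mem_ball_zero_iff.1 hη).le _)
  · have h1 : HasFDerivAt (fun η : E => ⟪η, X ω⟫_ℝ) (innerSL ℝ (X ω)) η := by
      refine (innerSL ℝ (X ω)).hasFDerivAt.congr_of_eventuallyEq (Eventually.of_forall fun η => ?_)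
      exact real_inner_comm _ _
    refine (h1.exp.smul_const (g ω)).congr_fderiv ?_
    ext v
    simp [mul_smul]

lemma hasGradientAt_logMGF {P : Measure Ω} [IsProbabilityMeasure P] {X : Ω → E}
    (hX : Measurable X) {r : ℝ} (hr : 0 < r)
    (hint : Integrable (fun ω => Real.exp (r * ‖X ω‖)) P) {θ : E} (hθ : ‖θ‖ < r / 2) :
    HasGradientAt (logMGF P X)
      ((∫ ω, Real.exp ⟪θ, X ω⟫_ℝ ∂P)⁻¹ • ∫ ω, Real.exp ⟪θ, X ω⟫_ℝ • X ω ∂P) θ := by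
  have h1 := hasFDerivAt_integral_exp_inner_smul hX hr hint (g := fun _ => (1 : ℝ))
    aestronglyMeasurable_const (k := 0) (by simp) hθ
  have h2 := integrable_exp_inner_smul hX hr hint (g := fun _ => (1 : ℝ))
    aestronglyMeasurable_const (k := 0) (by simp) hθ.le
  have h3 := integrable_exp_inner_smul hX hr hint hX.aestronglyMeasurable (k := 1) (by simp) hθ.le
  simp only [smul_eq_mul, mul_one] at h1 h2
  rw [hasGradientAt_iff_hasFDerivAt]
  refine (h1.log (integral_exp_pos h2).ne').congr_fderiv ?_
  have : ∀ ω, Real.exp ⟪θ, X ω⟫_ℝ • (innerSL ℝ (X ω)).smulRight (1 : ℝ) =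
      innerSL ℝ (Real.exp ⟪θ, X ω⟫_ℝ • X ω) := fun ω => by
    ext v; simp
  simp_rw [this]
  rw [ContinuousLinearMap.integral_comp_comm _ h3, ← map_smul]
  rfl

lemma eventually_differentiableAt_logMGF {P : Measure Ω} [IsProbabilityMeasure P] {X : Ω → E}
    (hX : Measurable X)
    (hmgf : ∀ᶠ θ in 𝓝 (0 : E), Integrable (fun ω => Real.exp ⟪θ, X ω⟫_ℝ) P) :
    ∀ᶠ θ in 𝓝 (0 : E), DifferentiableAt ℝ (logMGF P X) θ := by
  obtain ⟨r, hr, hint⟩ := exists_integrable_exp_mul_norm hX hmgf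
  filter_upwards [Metric.ball_mem_nhds (0 : E) (half_pos hr)] with θ hθ
  exact (hasGradientAt_logMGF hX hr hint (mem_ball_zero_iff.1 hθ)).differentiableAt

lemma differentiableAt_gradient_logMGF {P : Measure Ω} [IsProbabilityMeasure P] {X : Ω → E}
    (hX : Measurable X)
    (hmgf : ∀ᶠ θ in 𝓝 (0 : E), Integrable (fun ω => Real.exp ⟪θ, X ω⟫_ℝ) P) :
    DifferentiableAt ℝ (gradient (logMGF P X)) 0 := by
  obtain ⟨r, hr, hint⟩ := exists_integrable_exp_mul_norm hX hmgf
  have h0 : ‖(0 : E)‖ < r / 2 := by simpa using half_pos hr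
  have h1 := hasFDerivAt_integral_exp_inner_smul hX hr hint (g := fun _ => (1 : ℝ))
    aestronglyMeasurable_const (k := 0) (by simp) h0
  have h2 := hasFDerivAt_integral_exp_inner_smul hX hr hint hX.aestronglyMeasurable (k := 1)
    (by simp) h0
  simp only [smul_eq_mul, mul_one] at h1
  have h3 := (h1.differentiableAt.inv (by simp)).smul h2.differentiableAt
  refine h3.congr_of_eventuallyEq ?_
  filter_upwards [Metric.ball_mem_nhds (0 : E) (half_pos hr)] with θ hθ
  exact (hasGradientAt_logMGF hX hr hint (mem_ball_zero_iff.1 hθ)).gradient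

omit [MeasurableSpace E] [BorelSpace E] in
-- Symmetry of second derivatives. It merges the cross terms when tilting, and makes the range of
-- the Hessian the orthogonal complement of its kernel.
lemma inner_hessian_comm {f : E → ℝ} {x : E} (hf : ∀ᶠ y in 𝓝 x, DifferentiableAt ℝ f y)
    (hf' : DifferentiableAt ℝ (gradient f) x) (u v : E) :
    ⟪u, hessian f x v⟫_ℝ = ⟪v, hessian f x u⟫_ℝ := by
  have h1 : ∀ᶠ y in 𝓝 x, HasFDerivAt f (innerSL ℝ (gradient f y)) y :=
    hf.mono fun y hy => hy.hasGradientAt.hasFDerivAt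
  have h2 : HasFDerivAt (fun y => innerSL ℝ (gradient f y)) ((innerSL ℝ).comp (hessian f x)) x :=
    (innerSL ℝ (E := E)).hasFDerivAt.comp x hf'.hasFDerivAt
  have := second_derivative_symmetric_of_eventually h1 h2 v u
  simp only [ContinuousLinearMap.comp_apply, innerSL_apply_apply] at this
  rw [real_inner_comm, this, real_inner_comm]

end LogMGF

/-! ### Scaled cumulants of the normalised sums. -/

section ScaledSum

variable {Ω E : Type*} [MeasurableSpace Ω] [NormedAddCommGroup E] [InnerProductSpace ℝ E]

/-- Second order Taylor expansion at `0` along a ray. -/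
lemma tendsto_sub_gradient_div_sq [CompleteSpace E] {f : E → ℝ}
    (hf : ∀ᶠ y in 𝓝 (0 : E), DifferentiableAt ℝ f y)
    (hf' : DifferentiableAt ℝ (gradient f) 0) (hf0 : f 0 = 0) (θ : E) :
    Tendsto (fun t : ℝ => (f (t • θ) - t * ⟪θ, gradient f 0⟫_ℝ) / t ^ 2) (𝓝[>] 0)
      (𝓝 (⟪θ, hessian f 0 θ⟫_ℝ / 2)) := by
  have hline : ∀ t : ℝ, HasDerivAt (fun t : ℝ => t • θ) θ t := fun t => by
    simpa using (hasDerivAt_id t).smul_const θ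
  have hcont : Tendsto (fun t : ℝ => t • θ) (𝓝 0) (𝓝 (0 : E)) := by
    simpa using (hline 0).continuousAt.tendsto
  have hder : ∀ᶠ t : ℝ in 𝓝 0, HasDerivAt (fun t : ℝ => f (t • θ) - t * ⟪θ, gradient f 0⟫_ℝ)
      (⟪gradient f (t • θ), θ⟫_ℝ - ⟪θ, gradient f 0⟫_ℝ) t := by
    filter_upwards [hcont.eventually hf] with t ht
    refine (ht.hasGradientAt.hasFDerivAt.comp_hasDerivAt t (hline t)).sub ?_
    simpa using (hasDerivAt_id t).mul_const ⟪θ, gradient f 0⟫_ℝ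
  have hgrad : HasDerivAt (fun t : ℝ => ⟪gradient f (t • θ), θ⟫_ℝ) ⟪hessian f 0 θ, θ⟫_ℝ 0 := by
    have h1 : HasDerivAt (fun t : ℝ => gradient f (t • θ)) (hessian f 0 θ) 0 := by
      refine HasFDerivAt.comp_hasDerivAt (f := fun t : ℝ => t • θ) (l := gradient f) 0 ?_ (hline 0)
      simpa [hessian] using hf'.hasFDerivAt
    simpa using h1.inner ℝ (hasDerivAt_const (0 : ℝ) θ)
  -- The gradient is differentiable only at `0`, so l'Hôpital is used once; the remaining quotient
  -- is half a difference quotient of the gradient.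
  refine HasDerivAt.lhopital_zero_nhdsGT (hder.filter_mono nhdsWithin_le_nhds)
    (g' := fun t => 2 * t) ?_ ?_ ?_ ?_ ?_
  · exact Eventually.of_forall fun t => by simpa using hasDerivAt_pow 2 t
  · filter_upwards [self_mem_nhdsWithin] with t ht
    exact mul_ne_zero two_ne_zero (ne_of_gt ht)
  · have := hder.self_of_nhds.continuousAt.tendsto
    simp only [zero_smul, hf0, zero_mul, sub_zero] at this
    exact this.mono_left nhdsWithin_le_nhds
  · have : Tendsto (fun t : ℝ => t ^ 2) (𝓝 0) (𝓝 0) := by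
      simpa using (continuous_pow 2).tendsto (0 : ℝ)
    exact this.mono_left nhdsWithin_le_nhds
  · have h := (hgrad.tendsto_slope_zero_right).div_const 2
    simp only [zero_add, zero_smul, smul_eq_mul] at h
    rw [real_inner_comm (hessian f 0 θ)]
    refine h.congr fun t => ?_
    rw [real_inner_comm (gradient f 0) θ]
    field_simp

lemma inner_scaledSum_div [CompleteSpace E] (P : Measure Ω) (X : ℕ → Ω → E) {a : ℕ → ℝ} {n : ℕ}
    (ha : 0 < a n) (θ : E) (ω : Ω) :
    ⟪θ, scaledSum P X a n ω⟫_ℝ / a n = (∑ i ∈ Finset.range n, ⟪(√(n * a n))⁻¹ • θ, X i ω⟫_ℝ) -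
      n * ((√(n * a n))⁻¹ * ⟪θ, gradient (logMGF P (X 0)) 0⟫_ℝ) := by
  have h : √(n * a n) = √(n / a n) * a n := by
    rw [← Real.sqrt_sq ha.le, ← Real.sqrt_mul (by positivity), Real.sqrt_sq ha.le]
    congr 1
    field_simp
  simp only [scaledSum, real_inner_smul_right, real_inner_smul_left, inner_sub_right, inner_sum,
    ← Finset.mul_sum]
  rw [h, mul_inv]
  field_simp

variable [MeasurableSpace E] [BorelSpace E] [SecondCountableTopology E]

lemma lintegral_exp_inner_scaledSum [CompleteSpace E] {P : Measure Ω} [IsProbabilityMeasure P]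
    {X : ℕ → Ω → E} (hX : ∀ i, Measurable (X i)) (hindep : iIndepFun X P)
    (hident : ∀ i, IdentDistrib (X i) (X 0) P P) {a : ℕ → ℝ} {n : ℕ} (ha : 0 < a n) (θ : E)
    (hint : Integrable (fun ω => Real.exp ⟪(√(n * a n))⁻¹ • θ, X 0 ω⟫_ℝ) P) :
    ∫⁻ ω, ENNReal.ofReal (Real.exp (⟪θ, scaledSum P X a n ω⟫_ℝ / a n)) ∂P =
      ENNReal.ofReal (Real.exp (n * (logMGF P (X 0) ((√(n * a n))⁻¹ • θ) -
        (√(n * a n))⁻¹ * ⟪θ, gradient (logMGF P (X 0)) 0⟫_ℝ))) := by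
  set t : ℝ := (√(n * a n))⁻¹
  set c : ℝ := ⟪θ, gradient (logMGF P (X 0)) 0⟫_ℝ
  set Y : ℕ → Ω → ℝ := fun i ω => ⟪t • θ, X i ω⟫_ℝ with hYdef
  have hφ : Measurable fun x : E => ⟪t • θ, x⟫_ℝ := measurable_id.const_inner
  have hY : ∀ i, Measurable (Y i) := fun i => hφ.comp (hX i)
  have hYindep : iIndepFun Y P := hindep.comp (fun _ x => ⟪t • θ, x⟫_ℝ) fun _ => hφ
  have hYident : ∀ i, IdentDistrib (Y i) (Y 0) P P := fun i => (hident i).comp hφ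
  have hYint : ∀ i, Integrable (fun ω => Real.exp (1 * Y i ω)) P := fun i => by
    have h0 : Integrable (fun ω => Real.exp (1 * Y 0 ω)) P := by simpa [hYdef] using hint
    exact ((hYident i).comp (u := fun y => Real.exp (1 * y)) (by fun_prop)).integrable_iff.2 h0
  have hsumint := hYindep.integrable_exp_mul_sum hY (s := Finset.range n) (t := 1)
    fun i _ => hYint i
  have hmgf : mgf (∑ i ∈ Finset.range n, Y i) P 1 = Real.exp (n * logMGF P (X 0) (t • θ)) := by
    rw [hYindep.mgf_sum hY, Finset.prod_congr rfl fun i _ =>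
      mgf_congr_of_identDistrib (Y i) (Y 0) (hYident i) 1, Finset.prod_const, Finset.card_range,
      Real.exp_nat_mul, logMGF, Real.exp_log (integral_exp_pos hint)]
    simp [mgf, hYdef]
  have hexp : ∀ ω, Real.exp (⟪θ, scaledSum P X a n ω⟫_ℝ / a n) =
      Real.exp (1 * (∑ i ∈ Finset.range n, Y i) ω) * Real.exp (-(n * (t * c))) := fun ω => by
    rw [inner_scaledSum_div P X ha, ← Real.exp_add]
    simp [hYdef, t, c, sub_eq_add_neg]
  simp_rw [hexp]
  rw [← ofReal_integral_eq_lintegral_ofReal (hsumint.mul_const _)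
    (ae_of_all _ fun ω => by positivity), integral_mul_const]
  change ENNReal.ofReal (mgf (∑ i ∈ Finset.range n, Y i) P 1 * _) = _
  rw [hmgf, ← Real.exp_add]
  ring_nf

/-- The scaled logarithmic moment generating functions of the normalised sums converge to a
quadratic form. -/
lemma eventually_lintegral_exp_inner_scaledSum [CompleteSpace E] {P : Measure Ω}
    [IsProbabilityMeasure P]
    {X : ℕ → Ω → E} (hX : ∀ i, Measurable (X i)) (hindep : iIndepFun X P)
    (hident : ∀ i, IdentDistrib (X i) (X 0) P P)
    (hmgf : ∀ᶠ θ in 𝓝 (0 : E), Integrable (fun ω => Real.exp ⟪θ, X 0 ω⟫_ℝ) P)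
    (hκ : ∀ᶠ θ in 𝓝 (0 : E), DifferentiableAt ℝ (logMGF P (X 0)) θ)
    (hκ' : DifferentiableAt ℝ (gradient (logMGF P (X 0))) 0)
    {a : ℕ → ℝ} (ha : ∀ᶠ n in atTop, 0 < a n)
    (hna : Tendsto (fun n : ℕ => (n : ℝ) * a n) atTop atTop) (θ : E) {ε : ℝ} (hε : 0 < ε) :
    ∀ᶠ n in atTop, ∫⁻ ω, ENNReal.ofReal (Real.exp (⟪θ, scaledSum P X a n ω⟫_ℝ / a n)) ∂P ∈
      Set.Icc (ENNReal.ofReal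
        (Real.exp ((⟪θ, hessian (logMGF P (X 0)) 0 θ⟫_ℝ / 2 - ε) / a n)))
        (ENNReal.ofReal (Real.exp ((⟪θ, hessian (logMGF P (X 0)) 0 θ⟫_ℝ / 2 + ε) / a n))) := by
  have ht0 : Tendsto (fun n : ℕ => (√(n * a n))⁻¹) atTop (𝓝 0) :=
    (Real.tendsto_sqrt_atTop.comp hna).inv_tendsto_atTop
  have ht : Tendsto (fun n : ℕ => (√(n * a n))⁻¹) atTop (𝓝[>] 0) := by
    refine tendsto_nhdsWithin_iff.2 ⟨ht0, ?_⟩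
    filter_upwards [hna.eventually_gt_atTop 0] with n hn
    exact inv_pos.2 (Real.sqrt_pos.2 hn)
  have hlim := (tendsto_sub_gradient_div_sq hκ hκ' (by simp [logMGF]) θ).comp ht
  have hsmul : Tendsto (fun n : ℕ => (√(n * a n))⁻¹ • θ) atTop (𝓝 (0 : E)) := by
    simpa using ht0.smul_const θ
  filter_upwards [ha, hna.eventually_gt_atTop 0, hsmul.eventually hmgf,
    hlim.eventually (Ioo_mem_nhds (sub_lt_self _ hε) (lt_add_of_pos_right _ hε))]
    with n hn hnn hint hmem
  -- Since `n = 1 / (t² a_n)` for `t = (n a_n)^(-1/2)`, the factor `n` becomes the Taylor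
  -- denominator `t²` and the speed.
  have hscale : ∀ y : ℝ, y / ((√(n * a n))⁻¹) ^ 2 / a n = n * y := fun y => by
    rw [inv_pow, Real.sq_sqrt hnn.le]
    field_simp
  rw [lintegral_exp_inner_scaledSum hX hindep hident hn θ hint, ← hscale]
  exact ⟨ENNReal.ofReal_le_ofReal (Real.exp_le_exp.2 (by gcongr; exact hmem.1.le)),
    ENNReal.ofReal_le_ofReal (Real.exp_le_exp.2 (by gcongr; exact hmem.2.le))⟩

end ScaledSum

/-! ### Gärtner–Ellis bounds. -/

section GartnerEllis

variable {E : Type*} [NormedAddCommGroup E] [InnerProductSpace ℝ E] [FiniteDimensional ℝ E]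

/-- A closed set that is covered by the open half-spaces `{ℓ < ⟪θ, y⟫ - Λ θ}` is covered by finitely
many of their closed counterparts. -/
lemma IsClosed.exists_finset_le_inner_sub {C : Set E} (hC : IsClosed C) (Λ : E → ℝ) {l : ℝ}
    (h : ∀ y ∈ C, ∃ θ, l < ⟪θ, y⟫_ℝ - Λ θ) :
    ∃ T : Finset E, ∀ y ∈ C, ∃ θ ∈ T, l ≤ ⟪θ, y⟫_ℝ - Λ θ := by
  classical
  set b := stdOrthonormalBasis ℝ E
  -- If a coordinate of `y` exceeds `R` in absolute value, `b i` or `-b i` already works. This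
  -- settles all `y` outside the ball of radius `n R`; a finite subcover handles the rest.
  set R : ℝ := ∑ i, (|Λ (b i) + l| + |Λ (-b i) + l|)
  have hR : ∀ i, Λ (b i) + l ≤ R ∧ Λ (-b i) + l ≤ R := fun i => by
    have h1 : |Λ (b i) + l| + |Λ (-b i) + l| ≤ R :=
      Finset.single_le_sum (f := fun i => |Λ (b i) + l| + |Λ (-b i) + l|)
        (fun i _ => by positivity) (Finset.mem_univ i)
    constructor <;> linarith [le_abs_self (Λ (b i) + l), le_abs_self (Λ (-b i) + l),
      abs_nonneg (Λ (b i) + l), abs_nonneg (Λ (-b i) + l)]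
  have hR0 : 0 ≤ R := Finset.sum_nonneg fun i _ => by positivity
  set n : ℝ := (Fintype.card (Fin (Module.finrank ℝ E)) : ℝ)
  have hn : 0 ≤ n := Nat.cast_nonneg _
  have hK : IsCompact (C ∩ Metric.closedBall 0 (n * R)) :=
    (isCompact_closedBall _ _).inter_left hC
  choose! τ hτ using h
  obtain ⟨S, -, hS⟩ := hK.elim_nhds_subcover (fun y => {z | l < ⟪τ y, z⟫_ℝ - Λ (τ y)})
    fun y hy => (isOpen_lt (by fun_prop) (by fun_prop)).mem_nhds (hτ y hy.1)
  refine ⟨S.image τ ∪ (Finset.univ.image (fun i => b i) ∪ Finset.univ.image fun i => -b i),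
    fun y hy => ?_⟩
  by_cases hyR : ‖y‖ ≤ n * R
  · obtain ⟨z, hz, hyz⟩ := Set.mem_iUnion₂.1 (hS ⟨hy, mem_closedBall_zero_iff.2 hyR⟩)
    exact ⟨τ z, by simp only [Finset.mem_union, Finset.mem_image]; exact Or.inl ⟨z, hz, rfl⟩,
      le_of_lt hyz⟩
  · push Not at hyR
    have hy0 : y ≠ 0 := norm_pos_iff.1 ((mul_nonneg hn hR0).trans_lt hyR)
    obtain ⟨i, hi⟩ := b.exists_norm_le_card_mul_abs_inner y hy0
    have hlt : R < |⟪b i, y⟫_ℝ| := lt_of_mul_lt_mul_left (hyR.trans_le hi) hn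
    rcases abs_choice ⟪b i, y⟫_ℝ with habs | habs <;> rw [habs] at hlt
    · exact ⟨b i, by simp, by linarith [(hR i).1]⟩
    · exact ⟨-b i, by simp, by rw [inner_neg_left]; linarith [(hR i).2]⟩

variable [MeasurableSpace E] [BorelSpace E] {a : ℕ → ℝ} {μ : ℕ → Measure E} {Λ : E → ℝ}

lemma eventually_const_le_exp_div (ha : ∀ᶠ n in atTop, 0 < a n) (ha0 : Tendsto a atTop (𝓝 0))
    (c : ℝ) {ε : ℝ} (hε : 0 < ε) : ∀ᶠ n in atTop, c ≤ Real.exp (ε / a n) := by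
  have h1 : Tendsto (fun n => (a n)⁻¹) atTop atTop :=
    tendsto_inv_nhdsGT_zero.comp (tendsto_nhdsWithin_iff.2 ⟨ha0, ha⟩)
  exact (Real.tendsto_exp_atTop.comp (h1.const_mul_atTop hε)).eventually_ge_atTop c

omit [FiniteDimensional ℝ E] in
/-- The exponential Chebyshev inequality for a half-space. -/
lemma measure_le_inner_sub_le (ν : Measure E) {s : ℝ} (hs : 0 < s) (θ : E) (p l ε : ℝ)
    (h : ∫⁻ x, ENNReal.ofReal (Real.exp (⟪θ, x⟫_ℝ / s)) ∂ν ≤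
      ENNReal.ofReal (Real.exp ((p + ε) / s))) :
    ν {x | l ≤ ⟪θ, x⟫_ℝ - p} ≤ ENNReal.ofReal (Real.exp ((-l + ε) / s)) := by
  have hmeas : Measurable fun x : E => ENNReal.ofReal (Real.exp (⟪θ, x⟫_ℝ / s)) := by fun_prop
  have hcheb := (mul_meas_ge_le_lintegral (μ := ν) hmeas
    (ENNReal.ofReal (Real.exp ((l + p) / s)))).trans h
  have hsub : {x | l ≤ ⟪θ, x⟫_ℝ - p} ⊆ {x : E | ENNReal.ofReal (Real.exp ((l + p) / s)) ≤
      ENNReal.ofReal (Real.exp (⟪θ, x⟫_ℝ / s))} := fun x (hx : l ≤ _) =>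
    ENNReal.ofReal_le_ofReal (Real.exp_le_exp.2 (by gcongr; linarith))
  have hle := (mul_le_mul_right (measure_mono (μ := ν) hsub)
    (ENNReal.ofReal (Real.exp ((l + p) / s)))).trans hcheb
  have heq : Real.exp ((p + ε) / s) = Real.exp ((l + p) / s) * Real.exp ((-l + ε) / s) := by
    rw [← Real.exp_add]; ring_nf
  rw [heq, ENNReal.ofReal_mul (Real.exp_pos _).le] at hle
  exact (ENNReal.mul_le_mul_iff_right (by simpa using Real.exp_pos _) ENNReal.ofReal_ne_top).1 hle

/-- The upper bound of the Gärtner–Ellis theorem. -/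
lemma eventually_measure_le_of_isClosed (ha : ∀ᶠ n in atTop, 0 < a n)
    (ha0 : Tendsto a atTop (𝓝 0))
    (hΛ : ∀ θ, ∀ ε > 0, ∀ᶠ n in atTop, ∫⁻ x, ENNReal.ofReal (Real.exp (⟪θ, x⟫_ℝ / a n)) ∂μ n ≤
      ENNReal.ofReal (Real.exp ((Λ θ + ε) / a n)))
    {C : Set E} (hC : IsClosed C) {l : ℝ} (h : ∀ y ∈ C, ∃ θ, l < ⟪θ, y⟫_ℝ - Λ θ)
    {ε : ℝ} (hε : 0 < ε) :
    ∀ᶠ n in atTop, μ n C ≤ ENNReal.ofReal (Real.exp ((-l + ε) / a n)) := by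
  obtain ⟨T, hT⟩ := hC.exists_finset_le_inner_sub Λ h
  -- The number of half-spaces costs at most `exp((ε / 2) / a_n)`.
  filter_upwards [ha, eventually_const_le_exp_div ha ha0 T.card (half_pos hε),
    (Finset.eventually_all T).2 fun θ _ => hΛ θ (ε / 2) (half_pos hε)] with n hn hcard hmgf
  calc μ n C ≤ μ n (⋃ θ ∈ T, {x | l ≤ ⟪θ, x⟫_ℝ - Λ θ}) :=
        measure_mono fun y hy => by simpa using hT y hy
    _ ≤ ∑ θ ∈ T, μ n {x | l ≤ ⟪θ, x⟫_ℝ - Λ θ} := measure_biUnion_finset_le _ _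
    _ ≤ ∑ _θ ∈ T, ENNReal.ofReal (Real.exp ((-l + ε / 2) / a n)) :=
        Finset.sum_le_sum fun θ hθ => measure_le_inner_sub_le _ hn θ _ l _ (hmgf θ hθ)
    _ = ENNReal.ofReal (T.card * Real.exp ((-l + ε / 2) / a n)) := by
        rw [Finset.sum_const, nsmul_eq_mul, ENNReal.ofReal_mul (Nat.cast_nonneg _),
          ENNReal.ofReal_natCast]
    _ ≤ ENNReal.ofReal (Real.exp ((-l + ε) / a n)) := by
        refine ENNReal.ofReal_le_ofReal ?_
        calc _ ≤ Real.exp (ε / 2 / a n) * Real.exp ((-l + ε / 2) / a n) := by gcongr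
          _ = _ := by rw [← Real.exp_add]; ring_nf

omit [FiniteDimensional ℝ E] [MeasurableSpace E] [BorelSpace E] in
/-- At a point other than `H η` the tilted quadratic form has a positive Legendre transform. -/
lemma exists_lt_inner_sub_quadratic (H : E →L[ℝ] E) (hH : ∀ u v : E, ⟪u, H v⟫_ℝ = ⟪v, H u⟫_ℝ)
    (η y : E) {δ : ℝ} (hδ : 0 < δ) (hy : δ ≤ ‖y - H η‖) :
    ∃ θ, δ ^ 2 / (4 * (‖H‖ + 1)) - ⟪η, H η⟫_ℝ / 2 <
      ⟪θ, y⟫_ℝ - ⟪θ + η, H (θ + η)⟫_ℝ / 2 := by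
  set v := y - H η with hv
  -- With `θ = s v` the quadratic loss is at most half of the gain `s ‖v‖²`; the 4 in the bound
  -- leaves the inequality strict.
  set s : ℝ := (‖H‖ + 1)⁻¹
  have hs : 0 < s := by positivity
  have hsH : s * ‖H‖ ≤ 1 := by
    have h1 : s * (‖H‖ + 1) = 1 := inv_mul_cancel₀ (by positivity)
    linarith
  have hvH : ⟪v, H v⟫_ℝ ≤ ‖H‖ * ‖v‖ ^ 2 := by
    calc _ ≤ ‖v‖ * ‖H v‖ := real_inner_le_norm _ _
      _ ≤ ‖v‖ * (‖H‖ * ‖v‖) := by gcongr; exact H.le_opNorm v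
      _ = _ := by ring
  refine ⟨s • v, ?_⟩
  have hy' : y = v + H η := by rw [hv]; abel
  have hexpand : ⟪s • v, y⟫_ℝ - ⟪s • v + η, H (s • v + η)⟫_ℝ / 2 =
      s * ‖v‖ ^ 2 - s ^ 2 * ⟪v, H v⟫_ℝ / 2 - ⟪η, H η⟫_ℝ / 2 := by
    rw [hy']
    simp only [map_add, map_smul, inner_add_left, inner_add_right, real_inner_smul_left,
      real_inner_smul_right, real_inner_self_eq_norm_sq, hH η v]
    ring
  have hδv : δ ^ 2 ≤ ‖v‖ ^ 2 := by gcongr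
  have hdiv : δ ^ 2 / (4 * (‖H‖ + 1)) = s * δ ^ 2 / 4 := by
    simp only [s]; field_simp
  rw [hexpand, hdiv]
  have h1 : s ^ 2 * ⟪v, H v⟫_ℝ ≤ s * ‖v‖ ^ 2 := by
    calc s ^ 2 * ⟪v, H v⟫_ℝ ≤ s ^ 2 * (‖H‖ * ‖v‖ ^ 2) := by gcongr
      _ = (s * ‖H‖) * (s * ‖v‖ ^ 2) := by ring
      _ ≤ 1 * (s * ‖v‖ ^ 2) := by gcongr
      _ = _ := one_mul _
  have h2 : s * δ ^ 2 ≤ s * ‖v‖ ^ 2 := by gcongr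
  have h3 : 0 < s * δ ^ 2 := by positivity
  linarith

/-- The lower bound of the Gärtner–Ellis theorem at `H η`, for a quadratic limit. -/
lemma eventually_le_measure_of_isOpen [∀ n, IsFiniteMeasure (μ n)]
    (ha : ∀ᶠ n in atTop, 0 < a n) (ha0 : Tendsto a atTop (𝓝 0))
    (H : E →L[ℝ] E) (hH : ∀ u v : E, ⟪u, H v⟫_ℝ = ⟪v, H u⟫_ℝ)
    (hΛ : ∀ θ, ∀ ε > 0, ∀ᶠ n in atTop, ∫⁻ x, ENNReal.ofReal (Real.exp (⟪θ, x⟫_ℝ / a n)) ∂μ n ∈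
      Set.Icc (ENNReal.ofReal (Real.exp ((⟪θ, H θ⟫_ℝ / 2 - ε) / a n)))
        (ENNReal.ofReal (Real.exp ((⟪θ, H θ⟫_ℝ / 2 + ε) / a n))))
    {G : Set E} (hG : IsOpen G) {η : E} (hη : H η ∈ G) {ε : ℝ} (hε : 0 < ε) :
    ∀ᶠ n in atTop, ENNReal.ofReal (Real.exp ((-(⟪η, H η⟫_ℝ / 2) - ε) / a n)) ≤ μ n G := by
  obtain ⟨δ₀, hδ₀, hball₀⟩ := Metric.isOpen_iff.1 hG _ hη
  obtain ⟨δ, hδ, hball, hηδ⟩ : ∃ δ > 0, Metric.ball (H η) δ ⊆ G ∧ ‖η‖ * δ ≤ ε / 3 := by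
    refine ⟨min δ₀ (ε / (3 * (‖η‖ + 1))), by positivity,
      (Metric.ball_subset_ball (min_le_left _ _)).trans hball₀, ?_⟩
    calc ‖η‖ * min δ₀ (ε / (3 * (‖η‖ + 1))) ≤ (‖η‖ + 1) * (ε / (3 * (‖η‖ + 1))) :=
          mul_le_mul (by linarith) (min_le_right _ _) (by positivity) (by positivity)
      _ = ε / 3 := by field_simp
  set l₀ : ℝ := δ ^ 2 / (4 * (‖H‖ + 1))
  have hl₀ : 0 < l₀ := by positivity
  -- `l₀ / 4` makes the tilted mass off the ball at most `exp((q / 2 - 2 ε₁) / a_n)`, with `q = ⟨η,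
  -- Hη⟩`; `ε / 3` keeps the final loss `ε / 3 + 2 ε₁` below `ε`.
  set ε₁ : ℝ := min (l₀ / 4) (ε / 3)
  have hε₁ : 0 < ε₁ := by positivity
  have hε₁l : ε₁ ≤ l₀ / 4 := min_le_left _ _
  have hε₁ε : ε₁ ≤ ε / 3 := min_le_right _ _
  set w : ℕ → E → ENNReal := fun n x => ENNReal.ofReal (Real.exp (⟪η, x⟫_ℝ / a n))
  have hw : ∀ n, Measurable (w n) := fun n => by fun_prop
  -- The tilted measures are not normalised: their total mass is about `exp((q / 2) / a_n)`, hence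
  -- the shift by `-⟨η, Hη⟩ / 2` in the bound for the complement.
  set ν : ℕ → Measure E := fun n => (μ n).withDensity (w n)
  have hν : ∀ θ n, ∫⁻ x, ENNReal.ofReal (Real.exp (⟪θ, x⟫_ℝ / a n)) ∂ν n =
      ∫⁻ x, ENNReal.ofReal (Real.exp (⟪θ + η, x⟫_ℝ / a n)) ∂μ n := fun θ n => by
    rw [lintegral_withDensity_eq_lintegral_mul _ (hw n) (by fun_prop)]
    refine lintegral_congr fun x => ?_
    rw [Pi.mul_apply, ← ENNReal.ofReal_mul (Real.exp_pos _).le, ← Real.exp_add, inner_add_left]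
    ring_nf
  have hcompl := eventually_measure_le_of_isClosed (μ := ν)
    (Λ := fun θ => ⟪θ + η, H (θ + η)⟫_ℝ / 2) ha ha0
    (fun θ ε hε => (hΛ (θ + η) ε hε).mono fun n hn => by rw [hν]; exact hn.2)
    (Metric.isOpen_ball (x := H η) (ε := δ)).isClosed_compl (l := l₀ - ⟪η, H η⟫_ℝ / 2)
    (fun y hy => exists_lt_inner_sub_quadratic H hH η y hδ (by
      simpa [dist_eq_norm] using hy)) (half_pos hl₀)
  filter_upwards [ha, hcompl, hΛ η ε₁ hε₁, eventually_const_le_exp_div ha ha0 2 hε₁]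
    with n hn hncompl hnη hn2
  set q : ℝ := ⟪η, H η⟫_ℝ
  set B := Metric.ball (H η) δ
  have huniv : ν n Set.univ = ∫⁻ x, ENNReal.ofReal (Real.exp (⟪η, x⟫_ℝ / a n)) ∂μ n := by
    rw [withDensity_apply _ MeasurableSet.univ, Measure.restrict_univ]
  have hadd : ν n B + ν n Bᶜ = ν n Set.univ :=
    measure_add_measure_compl Metric.isOpen_ball.measurableSet
  have hreal : Real.exp ((q / 2 - 2 * ε₁) / a n) + Real.exp ((-(l₀ - q / 2) + l₀ / 2) / a n) ≤
      Real.exp ((q / 2 - ε₁) / a n) := by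
    have h1 : Real.exp ((-(l₀ - q / 2) + l₀ / 2) / a n) ≤ Real.exp ((q / 2 - 2 * ε₁) / a n) :=
      Real.exp_le_exp.2 (by gcongr; linarith)
    have h2 : Real.exp ((q / 2 - ε₁) / a n) =
        Real.exp (ε₁ / a n) * Real.exp ((q / 2 - 2 * ε₁) / a n) := by
      rw [← Real.exp_add]; ring_nf
    rw [h2]
    nlinarith [Real.exp_pos ((q / 2 - 2 * ε₁) / a n)]
  have hB : ENNReal.ofReal (Real.exp ((q / 2 - 2 * ε₁) / a n)) ≤ ν n B := by
    refine ENNReal.le_of_add_le_add_right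
      (ENNReal.ofReal_ne_top (r := Real.exp ((-(l₀ - q / 2) + l₀ / 2) / a n))) ?_
    rw [← ENNReal.ofReal_add (Real.exp_pos _).le (Real.exp_pos _).le]
    calc _ ≤ ENNReal.ofReal (Real.exp ((q / 2 - ε₁) / a n)) := ENNReal.ofReal_le_ofReal hreal
      _ ≤ ν n B + ν n Bᶜ := by rw [hadd, huniv]; exact hnη.1
      _ ≤ _ := by gcongr
  have hBμ : ν n B ≤ ENNReal.ofReal (Real.exp ((q + ε / 3) / a n)) * μ n B := by
    rw [withDensity_apply _ Metric.isOpen_ball.measurableSet]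
    refine (setLIntegral_mono measurable_const fun x hx => ENNReal.ofReal_le_ofReal
      (Real.exp_le_exp.2 (div_le_div_of_nonneg_right ?_ hn.le))).trans_eq
      (setLIntegral_const _ _)
    have h1 : ⟪η, x⟫_ℝ = q + ⟪η, x - H η⟫_ℝ := by simp [q, inner_sub_right]
    have h2 : ⟪η, x - H η⟫_ℝ ≤ ‖η‖ * δ := (real_inner_le_norm _ _).trans
      (mul_le_mul_of_nonneg_left (mem_ball_iff_norm.1 hx).le (norm_nonneg _))
    linarith
  have heq : Real.exp ((q / 2 - 2 * ε₁) / a n) =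
      Real.exp ((q + ε / 3) / a n) * Real.exp ((-(q / 2) - ε / 3 - 2 * ε₁) / a n) := by
    rw [← Real.exp_add]; ring_nf
  have hle := hB.trans hBμ
  rw [heq, ENNReal.ofReal_mul (Real.exp_pos _).le] at hle
  refine le_trans (ENNReal.ofReal_le_ofReal (Real.exp_le_exp.2 ?_))
    (((ENNReal.mul_le_mul_iff_right (by simpa using Real.exp_pos _)
      ENNReal.ofReal_ne_top).1 hle).trans (measure_mono hball))
  exact div_le_div_of_nonneg_right (by linarith) hn.le

end GartnerEllis

/-! ### The quadratic rate function. -/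

section QuadConjugate

variable {E : Type*} [NormedAddCommGroup E] [InnerProductSpace ℝ E] (H : E →L[ℝ] E)

lemma le_quadConjugate (θ x : E) :
    ((⟪θ, x⟫_ℝ - ⟪θ, H θ⟫_ℝ / 2 : ℝ) : EReal) ≤ quadConjugate H x :=
  le_iSup (fun θ : E => ((⟪θ, x⟫_ℝ - ⟪θ, H θ⟫_ℝ / 2 : ℝ) : EReal)) θ

lemma quadConjugate_nonneg (x : E) : 0 ≤ quadConjugate H x := by
  simpa using le_quadConjugate H 0 x

lemma lowerSemicontinuous_quadConjugate : LowerSemicontinuous (quadConjugate H) :=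
  lowerSemicontinuous_iSup fun θ => Continuous.lowerSemicontinuous <|
    continuous_coe_real_ereal.comp (by fun_prop)

/-- Test the supremum with the unit vector in the direction of `x`. -/
lemma norm_le_of_quadConjugate_le {x : E} {η : ℝ} (hη : 0 ≤ η) (hx : quadConjugate H x ≤ η) :
    ‖x‖ ≤ η + ‖H‖ / 2 := by
  rcases eq_or_ne x 0 with rfl | hx0
  · simp only [norm_zero]; positivity
  have hpos : 0 < ‖x‖ := norm_pos_iff.2 hx0
  set u : E := ‖x‖⁻¹ • x
  have hu : ‖u‖ = 1 := by simp [u, norm_smul, hpos.ne']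
  have h1 : ⟪u, x⟫_ℝ = ‖x‖ := by
    simp only [u, real_inner_smul_left, real_inner_self_eq_norm_sq]
    field_simp
  have h2 : ⟪u, H u⟫_ℝ ≤ ‖H‖ := by
    calc _ ≤ ‖u‖ * ‖H u‖ := real_inner_le_norm _ _
      _ ≤ ‖H‖ := by simpa [hu] using H.le_opNorm u
  have h3 := EReal.coe_le_coe_iff.1 ((le_quadConjugate H u x).trans hx)
  linarith

lemma isGoodRateFunction_quadConjugate [FiniteDimensional ℝ E] :
    IsGoodRateFunction (quadConjugate H) := by
  refine ⟨⟨quadConjugate_nonneg H, lowerSemicontinuous_quadConjugate H⟩, fun η hη => ?_⟩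
  refine (isCompact_closedBall (0 : E) (η + ‖H‖ / 2)).of_isClosed_subset
    ((lowerSemicontinuous_quadConjugate H).isClosed_preimage _) fun x hx => ?_
  exact mem_closedBall_zero_iff.2 (norm_le_of_quadConjugate_le H hη hx)

/-- On the kernel of `H` the supremand is linear, so finiteness forces `x` to be orthogonal to the
kernel, that is, to lie in the range. -/
lemma exists_eq_of_quadConjugate_lt_top [FiniteDimensional ℝ E]
    (hH : ∀ u v : E, ⟪u, H v⟫_ℝ = ⟪v, H u⟫_ℝ) {x : E} (hx : quadConjugate H x < ⊤) :
    ∃ η, H η = x := by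
  have hsymm : (H : E →ₗ[ℝ] E).IsSymmetric := fun u v => by
    simp only [ContinuousLinearMap.coe_coe]
    rw [real_inner_comm, hH]
  suffices x ∈ (H : E →ₗ[ℝ] E).range by simpa using this
  rw [← Submodule.orthogonal_orthogonal (H : E →ₗ[ℝ] E).range, hsymm.orthogonal_range,
    Submodule.mem_orthogonal]
  intro θ hθ
  have hθ0 : H θ = 0 := hθ
  by_contra hne
  obtain ⟨c, hc⟩ := EReal.lt_iff_exists_real_btwn.1 hx
  -- This multiple of `θ` gives the supremand the value `c`, which lies above the supremum.
  have h1 := EReal.coe_lt_coe_iff.1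
    ((le_quadConjugate H ((c / ⟪θ, x⟫_ℝ) • θ) x).trans_lt hc.1)
  simp [real_inner_smul_left, hθ0, hne] at h1

end QuadConjugate

/-! ### From exponential bounds to the large deviation principle. -/

section LDP

variable {Ω : Type*} [MeasurableSpace Ω]

lemma coe_mul_log_ofReal_exp_div {s : ℝ} (hs : 0 < s) (z : ℝ) :
    (s : EReal) * ENNReal.log (ENNReal.ofReal (Real.exp (z / s))) = z := by
  rw [ENNReal.log_ofReal_of_pos (Real.exp_pos _), Real.log_exp, ← EReal.coe_mul,
    mul_div_cancel₀ _ hs.ne']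

lemma limsup_mul_log_le {a : ℕ → ℝ} (ha : ∀ᶠ n in atTop, 0 < a n) {m : ℕ → ENNReal} {z : ℝ}
    (h : ∀ᶠ n in atTop, m n ≤ ENNReal.ofReal (Real.exp (z / a n))) :
    limsup (fun n => ((1 / (1 / a n) : ℝ) : EReal) * ENNReal.log (m n)) atTop ≤ z := by
  refine limsup_le_of_le (by isBoundedDefault) ?_
  filter_upwards [ha, h] with n hn hmn
  rw [one_div_one_div, ← coe_mul_log_ofReal_exp_div hn z]
  exact mul_le_mul_of_nonneg_left (ENNReal.log_monotone hmn) (EReal.coe_nonneg.2 hn.le)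

lemma le_liminf_mul_log {a : ℕ → ℝ} (ha : ∀ᶠ n in atTop, 0 < a n) {m : ℕ → ENNReal} {z : ℝ}
    (h : ∀ᶠ n in atTop, ENNReal.ofReal (Real.exp (z / a n)) ≤ m n) :
    z ≤ liminf (fun n => ((1 / (1 / a n) : ℝ) : EReal) * ENNReal.log (m n)) atTop := by
  refine le_liminf_of_le (by isBoundedDefault) ?_
  filter_upwards [ha, h] with n hn hmn
  rw [one_div_one_div, ← coe_mul_log_ofReal_exp_div hn z]
  exact mul_le_mul_of_nonneg_left (ENNReal.log_monotone hmn) (EReal.coe_nonneg.2 hn.le)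

/-- The Gärtner–Ellis theorem for a quadratic limit. -/
lemma satisfiesLDP_quadConjugate {E : Type*} [NormedAddCommGroup E] [InnerProductSpace ℝ E]
    [FiniteDimensional ℝ E] [MeasurableSpace E] [BorelSpace E] {P : Measure Ω} [IsFiniteMeasure P]
    {B : ℕ → Ω → E} (hB : ∀ n, Measurable (B n)) {a : ℕ → ℝ} (ha : ∀ᶠ n in atTop, 0 < a n)
    (ha0 : Tendsto a atTop (𝓝 0)) (H : E →L[ℝ] E) (hH : ∀ u v : E, ⟪u, H v⟫_ℝ = ⟪v, H u⟫_ℝ)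
    (hΛ : ∀ θ, ∀ ε > 0, ∀ᶠ n in atTop,
      ∫⁻ ω, ENNReal.ofReal (Real.exp (⟪θ, B n ω⟫_ℝ / a n)) ∂P ∈
      Set.Icc (ENNReal.ofReal (Real.exp ((⟪θ, H θ⟫_ℝ / 2 - ε) / a n)))
        (ENNReal.ofReal (Real.exp ((⟪θ, H θ⟫_ℝ / 2 + ε) / a n)))) :
    SatisfiesLDP P B (fun n => 1 / a n) (quadConjugate H) := by
  have hmap : ∀ θ n, ∫⁻ x, ENNReal.ofReal (Real.exp (⟪θ, x⟫_ℝ / a n)) ∂(P.map (B n)) =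
      ∫⁻ ω, ENNReal.ofReal (Real.exp (⟪θ, B n ω⟫_ℝ / a n)) ∂P := fun θ n =>
    lintegral_map (by fun_prop) (hB n)
  simp_rw [← hmap] at hΛ
  refine ⟨?_, (isGoodRateFunction_quadConjugate H).1, fun C hC => ?_, fun G hG => ?_⟩
  · simp only [one_div]
    exact tendsto_inv_nhdsGT_zero.comp (tendsto_nhdsWithin_iff.2 ⟨ha0, ha⟩)
  · refine EReal.le_of_forall_lt_iff_le.1 fun z hz => limsup_mul_log_le ha ?_
    obtain ⟨l, hzl, hl⟩ := EReal.lt_iff_exists_real_btwn.1 (EReal.neg_lt_comm.1 hz)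
    have hzl' : -z < l := by exact_mod_cast hzl
    have h := eventually_measure_le_of_isClosed (μ := fun n => P.map (B n))
      (Λ := fun θ => ⟪θ, H θ⟫_ℝ / 2) (ε := l + z) ha ha0
      (fun θ ε hε => (hΛ θ ε hε).mono fun n hn => hn.2) hC (l := l)
      (fun y hy => by
        obtain ⟨θ, hθ⟩ := lt_iSup_iff.1 (hl.trans_le (iInf₂_le y hy))
        exact ⟨θ, EReal.coe_lt_coe_iff.1 hθ⟩) (by linarith)
    filter_upwards [h] with n hn
    rw [Measure.map_apply (hB n) hC.measurableSet] at hn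
    rwa [neg_add_cancel_left] at hn
  · refine EReal.ge_of_forall_gt_iff_ge.1 fun z hz => le_liminf_mul_log ha ?_
    have hz' := EReal.lt_neg_comm.1 hz
    simp only [iInf_lt_iff] at hz'
    obtain ⟨x, hxG, hx⟩ := hz'
    obtain ⟨η, rfl⟩ := exists_eq_of_quadConjugate_lt_top H hH (hx.trans_le le_top)
    -- Only the lower bound of the conjugate at `H η`, from `θ = η`, is needed.
    have hη : ⟪η, H η⟫_ℝ - ⟪η, H η⟫_ℝ / 2 < -z := by
      exact_mod_cast (le_quadConjugate H η (H η)).trans_lt hx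
    have h := eventually_le_measure_of_isOpen (μ := fun n => P.map (B n)) ha ha0 H hH hΛ hG hxG
      (ε := -z - ⟪η, H η⟫_ℝ / 2) (by linarith)
    filter_upwards [h] with n hn
    rw [Measure.map_apply (hB n) hG.measurableSet] at hn
    have hz2 : -(⟪η, H η⟫_ℝ / 2) - (-z - ⟪η, H η⟫_ℝ / 2) = z := by ring
    rwa [hz2] at hn

end LDP

/-! ### Contraction along a map continuous on `D`. -/

section Contraction

variable {S T : Type*} [TopologicalSpace S] [TopologicalSpace T] [T2Space S] {I : S → EReal}
  {D : Set S} {U : S → T}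

omit [TopologicalSpace S] [TopologicalSpace T] [T2Space S] in
lemma contractedRate_nonneg (hI : ∀ x, 0 ≤ I x) (y : T) : 0 ≤ contractedRate I D U y :=
  le_iInf₂ fun x _ => hI x

omit [T2Space S] in
lemma IsGoodRateFunction.isCompact_inter_closure (hI : IsGoodRateFunction I) {c : ℝ} (hc : 0 ≤ c) :
    IsCompact ({x | I x ≤ (c : EReal)} ∩ closure D) :=
  (hI.2 c hc).inter_right isClosed_closure

omit [TopologicalSpace T] [T2Space S] in
lemma inter_closure_subset_of_eq_top (hD : ∀ x ∈ closure D \ D, I x = ⊤) (c : ℝ) :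
    {x | I x ≤ (c : EReal)} ∩ closure D ⊆ D := fun x ⟨hx, hxD⟩ => by
  by_contra hxn
  rw [Set.mem_ofPred_eq, hD x ⟨hxD, hxn⟩] at hx
  exact EReal.coe_ne_top c (top_le_iff.1 hx)

/-- The infimum over a fibre is attained, by lower semicontinuity on a compact piece of the fibre.
-/
lemma setOf_contractedRate_le [T1Space T] (hI : IsGoodRateFunction I)
    (hD : ∀ x ∈ closure D \ D, I x = ⊤) (hU : ContinuousOn U D) {c : ℝ} (hc : 0 ≤ c) :
    {y | contractedRate I D U y ≤ (c : EReal)} = U '' ({x | I x ≤ (c : EReal)} ∩ closure D) := by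
  refine Set.Subset.antisymm (fun y hy => ?_) ?_
  · have hc1 : (0 : ℝ) ≤ c + 1 := by linarith
    have hK := hI.isCompact_inter_closure (D := D) hc1
    have hKD := inter_closure_subset_of_eq_top hD (c + 1)
    have hA : IsCompact (({x | I x ≤ ((c + 1 : ℝ) : EReal)} ∩ closure D) ∩ U ⁻¹' {y}) :=
      hK.of_isClosed_subset ((hU.mono hKD).preimage_isClosed_of_isClosed hK.isClosed
        isClosed_singleton) Set.inter_subset_left
    have hlt : contractedRate I D U y < ((c + 1 : ℝ) : EReal) :=
      lt_of_le_of_lt hy (EReal.coe_lt_coe_iff.2 (by linarith))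
    simp only [contractedRate, iInf_lt_iff] at hlt
    obtain ⟨x₁, ⟨hx₁D, hx₁y⟩, hx₁⟩ := hlt
    obtain ⟨x₀, ⟨⟨hx₀, hx₀D⟩, hx₀y⟩, hmin⟩ :=
      LowerSemicontinuousOn.exists_isMinOn
        (s := ({x | I x ≤ ((c + 1 : ℝ) : EReal)} ∩ closure D) ∩ U ⁻¹' {y})
        ⟨x₁, ⟨hx₁.le, subset_closure hx₁D⟩, hx₁y⟩ hA (hI.1.2.lowerSemicontinuousOn _)
    have hle : I x₀ ≤ contractedRate I D U y := by
      refine le_iInf₂ fun x hx => ?_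
      by_cases hxc : I x ≤ ((c + 1 : ℝ) : EReal)
      · exact isMinOn_iff.1 hmin x ⟨⟨hxc, subset_closure hx.1⟩, hx.2⟩
      · exact le_trans hx₀ (not_le.1 hxc).le
    exact ⟨x₀, ⟨hle.trans hy, hx₀D⟩, hx₀y⟩
  · rintro _ ⟨x, hx, rfl⟩
    exact (iInf₂_le (f := fun x _ => I x) x
      ⟨inter_closure_subset_of_eq_top hD c hx, rfl⟩).trans hx.1

/-- The contraction principle for good rate functions, goodness part. -/
lemma IsGoodRateFunction.contractedRate [T2Space T] (hI : IsGoodRateFunction I)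
    (hD : ∀ x ∈ closure D \ D, I x = ⊤) (hU : ContinuousOn U D) :
    IsGoodRateFunction (contractedRate I D U) := by
  have hcomp : ∀ c : ℝ, 0 ≤ c → IsCompact {y | _root_.contractedRate I D U y ≤ (c : EReal)} :=
    fun c hc => by
      rw [setOf_contractedRate_le hI hD hU hc]
      exact (hI.isCompact_inter_closure hc).image_of_continuousOn
        (hU.mono (inter_closure_subset_of_eq_top hD c))
  refine ⟨⟨contractedRate_nonneg hI.1.1, ?_⟩, hcomp⟩
  refine lowerSemicontinuous_iff_isClosed_preimage.2 fun c => ?_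
  by_cases hc : 0 ≤ c
  · induction c with
    | bot => simp at hc
    | top => simp
    | coe c => exact (hcomp c (EReal.coe_nonneg.1 hc)).isClosed
  · convert isClosed_empty
    exact Set.eq_empty_of_forall_notMem fun y hy =>
      hc ((contractedRate_nonneg hI.1.1 y).trans hy)

/-- The contraction principle for a map that is continuous on a set of full measure, if the rate
function is infinite on the rest of the closure of that set. -/
lemma SatisfiesLDP.contractedRate {Ω : Type*} [MeasurableSpace Ω] [T2Space T] {P : Measure Ω}
    {B : ℕ → Ω → S} {v : ℕ → ℝ} (hB : SatisfiesLDP P B v I) (hI : IsGoodRateFunction I)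
    (hBD : ∀ᶠ n in atTop, ∀ᵐ ω ∂P, B n ω ∈ D)
    (hD : ∀ x ∈ closure D \ D, I x = ⊤) (hU : ContinuousOn U D) :
    SatisfiesLDP P (fun n ω => U (B n ω)) v (contractedRate I D U) := by
  refine ⟨hB.1, (hI.contractedRate hD hU).1, fun C hC => ?_, fun O hO => ?_⟩
  · obtain ⟨F, hF, hFC⟩ := continuousOn_iff_isClosed.1 hU C hC
    have hmem : ∀ x ∈ D, U x ∈ C ↔ x ∈ F := fun x hx => by
      have := Set.ext_iff.1 hFC x
      simpa [hx] using this
    -- Intersecting with `closure D` keeps the set closed, does not change the probability, and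
    -- leaves outside `D` only points of infinite rate.
    have hcongr : ∀ᶠ n in atTop,
        ((1 / v n : ℝ) : EReal) * ENNReal.log (P {ω | U (B n ω) ∈ C}) =
        ((1 / v n : ℝ) : EReal) * ENNReal.log (P {ω | B n ω ∈ F ∩ closure D}) := by
      filter_upwards [hBD] with n hn
      congr 2
      refine measure_congr ?_
      filter_upwards [hn] with ω hω
      exact propext ((hmem _ hω).trans ⟨fun h => ⟨h, subset_closure hω⟩, fun h => h.1⟩)
    rw [limsup_congr hcongr]
    refine (hB.2.2.1 _ (hF.inter isClosed_closure)).trans (EReal.neg_le_neg_iff.2 ?_)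
    refine le_iInf₂ fun x hx => ?_
    by_cases hxD : x ∈ D
    · exact iInf₂_le_of_le (U x) ((hmem x hxD).2 hx.1)
        (iInf₂_le (f := fun x _ => I x) x ⟨hxD, rfl⟩)
    · rw [hD x ⟨hx.2, hxD⟩]
      exact le_top
  · obtain ⟨G, hG, hGO⟩ := continuousOn_iff'.1 hU O hO
    have hmem : ∀ x ∈ D, U x ∈ O ↔ x ∈ G := fun x hx => by
      have := Set.ext_iff.1 hGO x
      simpa [hx] using this
    have hcongr : ∀ᶠ n in atTop,
        ((1 / v n : ℝ) : EReal) * ENNReal.log (P {ω | U (B n ω) ∈ O}) =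
        ((1 / v n : ℝ) : EReal) * ENNReal.log (P {ω | B n ω ∈ G}) := by
      filter_upwards [hBD] with n hn
      congr 2
      refine measure_congr ?_
      filter_upwards [hn] with ω hω
      exact propext (hmem _ hω)
    rw [liminf_congr hcongr]
    refine le_trans (EReal.neg_le_neg_iff.2 ?_) (hB.2.2.2 G hG)
    refine le_iInf₂ fun y hy => le_iInf₂ fun x hx => iInf₂_le x ((hmem x hx.1).1 ?_)
    rw [hx.2]
    exact hy

end Contraction

/-! ### The moderate deviation principle. -/

lemma measurable_scaledSum {Ω E : Type*} [MeasurableSpace Ω] [NormedAddCommGroup E]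
    [InnerProductSpace ℝ E] [CompleteSpace E] [MeasurableSpace E] [BorelSpace E]
    [SecondCountableTopology E] (P : Measure Ω) {X : ℕ → Ω → E} (hX : ∀ i, Measurable (X i))
    (a : ℕ → ℝ) (n : ℕ) : Measurable (scaledSum P X a n) :=
  ((Finset.measurable_fun_sum _ fun i _ => hX i).sub_const _).const_smul _

theorem mainTheorem4 {Ω : Type*} [MeasurableSpace Ω] (P : Measure Ω) [IsProbabilityMeasure P]
    (h k : ℕ)
    (X : ℕ → Ω → EuclideanSpace ℝ (Fin h))
    (hX_meas : ∀ i, Measurable (X i))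
    (hX_indep : iIndepFun X P)
    (hX_ident : ∀ i, IdentDistrib (X i) (X 0) P P)
    (hX_mgf : ∀ᶠ θ in 𝓝 (0 : EuclideanSpace ℝ (Fin h)),
      Integrable (fun ω => Real.exp ⟪θ, X 0 ω⟫_ℝ) P)
    (a : ℕ → ℝ)
    (ha_pos : ∀ n, 1 ≤ n → 0 < a n)
    (ha_zero : Tendsto a atTop (𝓝 0))
    (ha_top : Tendsto (fun n : ℕ => (n : ℝ) * a n) atTop atTop)
    (D : Set (EuclideanSpace ℝ (Fin h)))
    (U : EuclideanSpace ℝ (Fin h) → EuclideanSpace ℝ (Fin k))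
    (hU : ContinuousOn U D)
    (hD_mem : ∀ n, 1 ≤ n → ∀ᵐ ω ∂P, scaledSum P X a n ω ∈ D)
    (hD_rate : ∀ x ∈ closure D \ D,
      quadConjugate (hessian (logMGF P (X 0)) 0) x = ⊤) :
    ((∀ᶠ θ in 𝓝 (0 : EuclideanSpace ℝ (Fin h)), DifferentiableAt ℝ (logMGF P (X 0)) θ) ∧
      DifferentiableAt ℝ (gradient (logMGF P (X 0))) 0) ∧
    SatisfiesLDP P (fun n ω => U (scaledSum P X a n ω)) (fun n => 1 / a n)
      (contractedRate (quadConjugate (hessian (logMGF P (X 0)) 0)) D U) ∧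
    IsGoodRateFunction
      (contractedRate (quadConjugate (hessian (logMGF P (X 0)) 0)) D U) := by
  have ha : ∀ᶠ n in atTop, 0 < a n := eventually_atTop.2 ⟨1, ha_pos⟩
  have hκ := eventually_differentiableAt_logMGF (hX_meas 0) hX_mgf
  have hκ' := differentiableAt_gradient_logMGF (hX_meas 0) hX_mgf
  have hgood := isGoodRateFunction_quadConjugate (hessian (logMGF P (X 0)) 0)
  have hldp := satisfiesLDP_quadConjugate (measurable_scaledSum P hX_meas a) ha ha_zero
    (hessian (logMGF P (X 0)) 0) (inner_hessian_comm hκ hκ') fun θ _ hε =>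
      eventually_lintegral_exp_inner_scaledSum hX_meas hX_indep hX_ident hX_mgf hκ hκ' ha ha_top θ hε
  exact ⟨⟨hκ, hκ'⟩, hldp.contractedRate hgood (eventually_atTop.2 ⟨1, hD_mem⟩) hD_rate hU,
    hgood.contractedRate hD_rate hU⟩
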